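/- Let $\mathcal X\in\mathfrak{Ghol}$ be a generalized analytic holonomy set: the germ at $0\in\mathbb C^4$ (coordinates $(u_1,v_1,u_2,v_2)$) of a set $\{v_i=v_i(u_1,u_2),\ i=1,2\}$, where $v_1,v_2$ are holomorphic near $0$ with $v_i=\tau_iu_i+(\text{terms of odd degree}\ge 3)$ such that - $\mathrm{Im}\,\tau_i>0$ for $i=1,2$ (the $\tau_i$ are the cusp shapes of $\mathcal X$); - $v_1(u_1,0)\not\equiv\tau_1u_1$ and $v_2(0,u_2)\not\equiv\tau_2u_2$; - $v_1$ is odd in $u_1$ and even in $u_2$, and $v_2$ is even in $u_1$ and odd in $u_2$; - $\frac{\partial v_1}{\partial u_2}=a\frac{\partial v_2}{\partial u_1}$ for some $a\in\mathbb C$; - every subgroup of $\mathrm{GL}_4(\mathbb Q)$ whose elements map the germ $\mathcal X$ onto itself is finite. Let $\mathrm{Aut}\,\mathcal X$ denote the group of all matrices in $\mathrm{GL}_4(\mathbb Q)$ whose linear action maps the germ $\mathcal X$ onto itself. Write $M\in\mathrm{GL}_4(\mathbb Q)$ in $2\times2$ blocks as $M=\begin{pmatrix}A_1&A_2\\A_3&A_4\end{pmatrix}$.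 Then $M$ is of Type I if $A_2=A_3=0$ and $\det A_1=\det A_4=1$; of Type II if $A_1=A_4=0$ and $\det A_2=\det A_3=1$; and of Type III if $\det A_j\ne0$ for all $j$, $\det A_1=\det A_4$, $\det A_2=\det A_3$, $\det A_1+\det A_3=1$ and $(\det A_1)A_1^{-1}A_2=-(\det A_3)A_3^{-1}A_4$. Let $\mathcal G$ be the subgroup of $\mathrm{Aut}\,\mathcal X$ generated by its elements of Types I, II and III, let $\iota=I\oplus(-I)$, and let $\mathfrak m_M$ be the minimal polynomial of $M$ over $\mathbb Q$. **Theorem.** Suppose that $\tau_1,\tau_2\in\mathbb Q(\sqrt{-2})$ and that $\mathcal G$ contains an element $M$ of Type III such that $\mathfrak m_M(x)$ is $x^2+x+1$ or $x^2-x+1$ and $\mathfrak m_{\iota M}(x)=x^4+1$. Then $\mathcal G=\langle M,\pm\iota\rangle$; in particular $\langle M,\pm\iota\rangle$ contains every element of Type III in $\mathrm{Aut}\,\mathcal X$. Moreover, with $N:=\iota M$ and $\eta:=(\iota N^2)^2$, $$\mathcal G=\{\pm\iota^{\epsilon_1}\eta^{\alpha_1}N^{\alpha_2}\iota^{\epsilon_2}\;:\;0\le\epsilon_1,\epsilon_2,\alpha_1\le1,\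 0\le\alpha_2\le3\}.$$ -/

import Mathlib

open scoped Topology

/-- Index set of the four coordinates `(u₁, v₁, u₂, v₂)`: `inl 0 = u₁`, `inl 1 = v₁`,
`inr 0 = u₂`, `inr 1 = v₂`. -/
abbrev Idx : Type := Fin 2 ⊕ Fin 2

/-- The analytic set `{v₁ = v₁(u₁, u₂), v₂ = v₂(u₁, u₂)}` in `ℂ⁴`. Only its germ at the origin is
ever used. -/
def graphSet (v₁ v₂ : ℂ × ℂ → ℂ) : Set (Idx → ℂ) :=
  {x | x (Sum.inl 1) = v₁ (x (Sum.inl 0), x (Sum.inr 0)) ∧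
       x (Sum.inr 1) = v₂ (x (Sum.inl 0), x (Sum.inr 0))}

/-- The linear action of a rational matrix on `ℂ⁴`. -/
noncomputable def ratAct (M : GL Idx ℚ) (x : Idx → ℂ) : Idx → ℂ :=
  ((M : Matrix Idx Idx ℚ).map (fun q : ℚ => (q : ℂ))).mulVec x

theorem ratAct_one (x : Idx → ℂ) : ratAct 1 x = x := by
  have h : ((1 : Matrix Idx Idx ℚ).map (fun q : ℚ => (q : ℂ))) = 1 :=
    Matrix.map_one _ (by simp) (by simp)
  simp [ratAct, h]

theorem ratAct_mul (M N : GL Idx ℚ) (x : Idx → ℂ) :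
    ratAct (M * N) x = ratAct M (ratAct N x) := by
  have h := Matrix.map_mul (L := (M : Matrix Idx Idx ℚ)) (M := (N : Matrix Idx Idx ℚ))
    (f := Rat.castHom ℂ)
  simp only [Rat.coe_castHom] at h
  simp only [ratAct, Units.val_mul, Matrix.mulVec_mulVec]
  exact congrArg (fun A => Matrix.mulVec A x) h

theorem ratAct_tendsto (M : GL Idx ℚ) :
    Filter.Tendsto (ratAct M) (𝓝 0) (𝓝 0) := by
  have hc : Continuous (ratAct M) := by
    unfold ratAct
    exact Continuous.matrix_mulVec continuous_const continuous_id
  have h0 : ratAct M 0 = 0 := by simp [ratAct]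
  simpa [h0] using hc.tendsto 0

/-- The matrices in `GL₄(ℚ)` whose linear action on `ℂ⁴` maps the germ at `0` of `X` onto itself,
i.e. the part of `Aut X` lying in `GL₄(ℚ)`. -/
def ratAut (X : Set (Idx → ℂ)) : Subgroup (GL Idx ℚ) where
  carrier := {M | ∀ᶠ x in 𝓝 (0 : Idx → ℂ), ratAct M x ∈ X ↔ x ∈ X}
  one_mem' := by simp [ratAct_one]
  mul_mem' := by
    intro M N hM hN
    have h := (ratAct_tendsto N).eventually hM
    filter_upwards [h, hN] with x h1 h2
    rw [ratAct_mul, h1, h2]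
  inv_mem' := by
    intro M hM
    have h := (ratAct_tendsto M⁻¹).eventually hM
    filter_upwards [h] with x h1
    rw [← ratAct_mul, mul_inv_cancel, ratAct_one] at h1
    exact h1.symm

/-- A generalized analytic holonomy set: the germ at the origin of the analytic set
`v_i = v_i(u₁, u₂)`, `i = 1, 2`, in `ℂ⁴`. The functions are holomorphic near the origin with linear
part `τ_i u_i`; by the parity conditions only terms of odd total degree occur in them. -/
structure GHol where
  v₁ : ℂ × ℂ → ℂ
  v₂ : ℂ × ℂ → ℂ
  /-- first cusp shape -/
  τ₁ : ℂ
  /-- second cusp shape -/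
  τ₂ : ℂ
  analytic₁ : AnalyticAt ℂ v₁ 0
  analytic₂ : AnalyticAt ℂ v₂ 0
  linear₁ : HasFDerivAt v₁ (τ₁ • ContinuousLinearMap.fst ℂ ℂ ℂ) 0
  linear₂ : HasFDerivAt v₂ (τ₂ • ContinuousLinearMap.snd ℂ ℂ ℂ) 0
  im_pos₁ : 0 < τ₁.im
  im_pos₂ : 0 < τ₂.im
  nonlinear₁ : ¬ ∀ᶠ u in 𝓝 (0 : ℂ), v₁ (u, 0) = τ₁ * u
  nonlinear₂ : ¬ ∀ᶠ u in 𝓝 (0 : ℂ), v₂ (0, u) = τ₂ * u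
  even₁ : ∀ᶠ u in 𝓝 (0 : ℂ × ℂ), v₁ (u.1, -u.2) = v₁ u
  odd₁ : ∀ᶠ u in 𝓝 (0 : ℂ × ℂ), v₁ (-u.1, u.2) = -v₁ u
  even₂ : ∀ᶠ u in 𝓝 (0 : ℂ × ℂ), v₂ (-u.1, u.2) = v₂ u
  odd₂ : ∀ᶠ u in 𝓝 (0 : ℂ × ℂ), v₂ (u.1, -u.2) = -v₂ u
  symm : ∃ a : ℂ, ∀ᶠ u in 𝓝 (0 : ℂ × ℂ),
    fderiv ℂ v₁ u (0, 1) = a * fderiv ℂ v₂ u (1, 0)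
  finite : ∀ H : Subgroup (GL Idx ℚ), H ≤ ratAut (graphSet v₁ v₂) → (H : Set (GL Idx ℚ)).Finite

/-- The part of `Aut 𝒳` lying in `GL₄(ℚ)`. -/
def GHol.aut (X : GHol) : Subgroup (GL Idx ℚ) := ratAut (graphSet X.v₁ X.v₂)

/-- The `2 × 2` blocks of `M = (A₁ A₂; A₃ A₄)`. -/
def blk₁ (M : GL Idx ℚ) : Matrix (Fin 2) (Fin 2) ℚ := (M : Matrix Idx Idx ℚ).toBlocks₁₁

/-- Upper right block. -/
def blk₂ (M : GL Idx ℚ) : Matrix (Fin 2) (Fin 2) ℚ := (M : Matrix Idx Idx ℚ).toBlocks₁₂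

/-- Lower left block. -/
def blk₃ (M : GL Idx ℚ) : Matrix (Fin 2) (Fin 2) ℚ := (M : Matrix Idx Idx ℚ).toBlocks₂₁

/-- Lower right block. -/
def blk₄ (M : GL Idx ℚ) : Matrix (Fin 2) (Fin 2) ℚ := (M : Matrix Idx Idx ℚ).toBlocks₂₂

/-- Type I: block diagonal with diagonal blocks of determinant `1`. -/
def IsTypeI (M : GL Idx ℚ) : Prop :=
  (blk₁ M).det = 1 ∧ (blk₄ M).det = 1 ∧ blk₂ M = 0 ∧ blk₃ M = 0

/-- Type II: block anti-diagonal with anti-diagonal blocks of determinant `1`. -/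
def IsTypeII (M : GL Idx ℚ) : Prop :=
  (blk₃ M).det = 1 ∧ (blk₂ M).det = 1 ∧ blk₁ M = 0 ∧ blk₄ M = 0

/-- Type III: all blocks are invertible, `det A₁ = det A₄`, `det A₂ = det A₃`,
`det A₁ + det A₃ = 1` and `(det A₁) A₁⁻¹ A₂ = -(det A₃) A₃⁻¹ A₄`. -/
def IsTypeIII (M : GL Idx ℚ) : Prop :=
  (blk₁ M).det ≠ 0 ∧ (blk₂ M).det ≠ 0 ∧ (blk₃ M).det ≠ 0 ∧ (blk₄ M).det ≠ 0 ∧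
  (blk₁ M).det = (blk₄ M).det ∧ (blk₂ M).det = (blk₃ M).det ∧
  (blk₁ M).det + (blk₃ M).det = 1 ∧
  (blk₁ M).det • ((blk₁ M)⁻¹ * blk₂ M) = -((blk₃ M).det • ((blk₃ M)⁻¹ * blk₄ M))

/-- The subgroup `𝒢` of `Aut 𝒳` generated by all its elements of Types I, II and III. -/
def GHol.typeGroup (X : GHol) : Subgroup (GL Idx ℚ) :=
  Subgroup.closure {M | M ∈ X.aut ∧ (IsTypeI M ∨ IsTypeII M ∨ IsTypeIII M)}

/-- `ι = I ⊕ (-I)`. -/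
def iotaGL : GL Idx ℚ where
  val := Matrix.fromBlocks 1 0 0 (-1)
  inv := Matrix.fromBlocks 1 0 0 (-1)
  val_inv := by simp [Matrix.fromBlocks_multiply]
  inv_val := by simp [Matrix.fromBlocks_multiply]

/-- The field `ℚ(√-2)` inside `ℂ`. -/
noncomputable def qSqrtNegTwo : IntermediateField ℚ ℂ :=
  IntermediateField.adjoin ℚ {((Real.sqrt 2 : ℝ) : ℂ) * Complex.I}

/-!
A rational automorphism of the germ preserves its tangent plane `{(u₁, τ₁ u₁, u₂, τ₂ u₂)}` and so
acts on it by a `2 × 2` matrix with entries in `K = ℚ(√-2)`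
(`GHol.exists_isTangentRep`, `IsTangentRep.entry_mem`). This action is faithful because `τ₁, τ₂` are
not real (`IsTangentRep.faithful`). Thus `Aut 𝒳`, which is finite, becomes a finite subgroup of
`GL₂(K)`. It contains `ι`, which acts by `diag(1, -1)`.

The hypotheses on `M` force `ι M` to act, up to conjugation by a diagonal matrix, by one explicit
matrix of order `8` (`entries_of_pow_four_eq_neg_one`). Then `I = N²`, `J = η` and `K = N² η` act as
the units of a quaternion algebra, and `1, I, J, K` is a basis of the `2 × 2` matrices, orthogonal
for the trace form.

Roots of unity in `K` are `±1`, so every automorphism has determinant `±1` on the tangent plane,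
and an automorphism of determinant `1` has an integral trace (`trace_eq_int_of_pow_eq_one`). Let `g`
be an automorphism of determinant `1`. The traces `a, b, c, d` of `g, gI, gJ, gK` are then integers,
`2g = a - bI - cJ - dK`, and `a² + b² + c² + d² = 4 det g = 4`. Hence `g` is one of the `24` Hurwitz
units, and each of these is `±` a word `ι^ε₁ η^α₁ N^α₂ ι^ε₂` (`exists_word_of_traces`). For
determinant `-1` one multiplies by `ι`. Consequently the words exhaust the whole of `Aut 𝒳`, and
`Aut 𝒳`, `𝒢`, `⟨M, ±ι⟩` and the set of words coincide.
-/

/-! ### The action on the tangent plane -/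

/-- The vector `(w₀, τ₁ w₀, w₁, τ₂ w₁)`, as a parametrization by `w ∈ ℂ²` of the tangent plane at the
origin of a generalized holonomy set with cusp shapes `τ₁, τ₂`. -/
def tangentVec (τ₁ τ₂ : ℂ) (w : Fin 2 → ℂ) : Idx → ℂ :=
  Sum.elim ![w 0, τ₁ * w 0] ![w 1, τ₂ * w 1]

/-- `g` preserves the tangent plane and acts on it, in the coordinates of `tangentVec`, by the
`2 × 2` matrix `A`. -/
def IsTangentRep (τ₁ τ₂ : ℂ) (g : GL Idx ℚ) (A : Matrix (Fin 2) (Fin 2) ℂ) : Prop :=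
  ∀ w, ratAct g (tangentVec τ₁ τ₂ w) = tangentVec τ₁ τ₂ (A.mulVec w)

theorem tangentVec_injective (τ₁ τ₂ : ℂ) : Function.Injective (tangentVec τ₁ τ₂) := by
  intro w w' h
  have h0 := congrFun h (Sum.inl 0)
  have h1 := congrFun h (Sum.inr 0)
  simp only [tangentVec, Sum.elim_inl, Sum.elim_inr, Matrix.cons_val_zero] at h0 h1
  ext i
  fin_cases i
  · exact h0
  · exact h1

theorem iotaGL_mul_self : iotaGL * iotaGL = 1 := Units.ext iotaGL.val_inv

theorem ratAct_neg (g : GL Idx ℚ) (x : Idx → ℂ) : ratAct (-g) x = -ratAct g x := by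
  ext i
  simp [ratAct, Matrix.mulVec, dotProduct, Finset.sum_neg_distrib]

theorem ratAct_apply (g : GL Idx ℚ) (x : Idx → ℂ) (i : Idx) :
    ratAct g x i = g i (Sum.inl 0) * x (Sum.inl 0) + g i (Sum.inl 1) * x (Sum.inl 1) +
      (g i (Sum.inr 0) * x (Sum.inr 0) + g i (Sum.inr 1) * x (Sum.inr 1)) := by
  simp [ratAct, Matrix.mulVec, dotProduct, Fin.sum_univ_two]

namespace IsTangentRep

variable {τ₁ τ₂ : ℂ} {g h : GL Idx ℚ} {A B : Matrix (Fin 2) (Fin 2) ℂ}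

theorem one : IsTangentRep τ₁ τ₂ 1 1 := by
  intro w
  rw [ratAct_one, Matrix.one_mulVec]

theorem mul (hA : IsTangentRep τ₁ τ₂ g A) (hB : IsTangentRep τ₁ τ₂ h B) :
    IsTangentRep τ₁ τ₂ (g * h) (A * B) := by
  intro w
  rw [ratAct_mul, hB, hA, Matrix.mulVec_mulVec]

theorem pow (hA : IsTangentRep τ₁ τ₂ g A) (n : ℕ) : IsTangentRep τ₁ τ₂ (g ^ n) (A ^ n) := by
  induction n with
  | zero => simpa using one
  | succ n ih => simpa [pow_succ] using ih.mul hA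

theorem neg (hA : IsTangentRep τ₁ τ₂ g A) : IsTangentRep τ₁ τ₂ (-g) (-A) := by
  intro w
  rw [ratAct_neg, hA, Matrix.neg_mulVec]
  ext i
  rcases i with i | i <;> fin_cases i <;> simp [tangentVec] <;> ring

theorem unique (hA : IsTangentRep τ₁ τ₂ g A) (hB : IsTangentRep τ₁ τ₂ g B) : A = B := by
  refine Matrix.mulVec_injective (funext fun w => tangentVec_injective τ₁ τ₂ ?_)
  rw [← hA w, ← hB w]

theorem iota : IsTangentRep τ₁ τ₂ iotaGL !![1, 0; 0, -1] := by
  intro w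
  ext i
  rw [ratAct_apply]
  rcases i with i | i <;> fin_cases i <;>
    simp [tangentVec, iotaGL, Matrix.mulVec, dotProduct]

/-- The action on the tangent plane determines a rational matrix: its entries occur as the
coordinates of `a + b τ` in the `ℚ`-independent numbers `1, τ`, as `τ` is not real. -/
theorem faithful (h₁ : 0 < τ₁.im) (h₂ : 0 < τ₂.im) (hg : IsTangentRep τ₁ τ₂ g A)
    (hh : IsTangentRep τ₁ τ₂ h A) : g = h := by
  have key : ∀ (τ : ℂ), 0 < τ.im → ∀ a b c d : ℚ, (a : ℂ) + b * τ = c + d * τ →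
      a = c ∧ b = d := by
    intro τ hτ a b c d e
    have him := congrArg Complex.im e
    simp at him
    have hb : b = d := by
      rcases him with h | h
      · exact h
      · exact absurd h hτ.ne'
    subst hb
    refine ⟨?_, rfl⟩
    exact_mod_cast add_right_cancel e
  have e : ∀ w i, ratAct g (tangentVec τ₁ τ₂ w) i = ratAct h (tangentVec τ₁ τ₂ w) i := by
    intro w i
    rw [hg w, hh w]
  ext i j
  have e₁ := e ![1, 0] i
  have e₂ := e ![0, 1] i
  rw [ratAct_apply, ratAct_apply] at e₁ e₂
  simp [tangentVec] at e₁ e₂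
  obtain ⟨k1, k2⟩ := key τ₁ h₁ _ _ _ _ e₁
  obtain ⟨k3, k4⟩ := key τ₂ h₂ _ _ _ _ e₂
  rcases j with j | j <;> fin_cases j <;> assumption

/-- A quadratic relation among rational matrices passes to their actions on the tangent plane. -/
theorem add_smul_add_eq_zero {k : GL Idx ℚ} {C : Matrix (Fin 2) (Fin 2) ℂ}
    (hg : IsTangentRep τ₁ τ₂ g A) (hh : IsTangentRep τ₁ τ₂ h B) (hk : IsTangentRep τ₁ τ₂ k C)
    {e : ℚ} (H : (g : Matrix Idx Idx ℚ) + e • (h : Matrix Idx Idx ℚ) +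
      (k : Matrix Idx Idx ℚ) = 0) :
    A + (e : ℂ) • B + C = 0 := by
  refine Matrix.mulVec_injective (funext fun w => tangentVec_injective τ₁ τ₂ ?_)
  have key : ∀ x i, ratAct g x i + e * ratAct h x i + ratAct k x i = 0 := by
    intro x i
    have hc : ∀ j, (g i j : ℂ) + e * (h i j : ℂ) + (k i j : ℂ) = 0 := by
      intro j
      have := congrFun (congrFun H i) j
      simp only [Matrix.add_apply, Matrix.smul_apply, smul_eq_mul, Matrix.zero_apply] at this
      exact_mod_cast this
    simp only [ratAct_apply]
    linear_combination x (Sum.inl 0) * hc (Sum.inl 0) + x (Sum.inl 1) * hc (Sum.inl 1) +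
      x (Sum.inr 0) * hc (Sum.inr 0) + x (Sum.inr 1) * hc (Sum.inr 1)
  have hlin : ∀ i, tangentVec τ₁ τ₂ ((A + (e : ℂ) • B + C).mulVec w) i =
      tangentVec τ₁ τ₂ (A.mulVec w) i + e * tangentVec τ₁ τ₂ (B.mulVec w) i +
        tangentVec τ₁ τ₂ (C.mulVec w) i := by
    rintro (i | i) <;> fin_cases i <;>
      simp [tangentVec, Matrix.add_mulVec, Matrix.smul_mulVec] <;> ring
  ext i
  rw [hlin, ← hg w, ← hh w, ← hk w, key, Matrix.zero_mulVec]
  rcases i with i | i <;> fin_cases i <;> simp [tangentVec]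

theorem entry_mem {K : IntermediateField ℚ ℂ} (h₁ : τ₁ ∈ K) (h₂ : τ₂ ∈ K)
    (hg : IsTangentRep τ₁ τ₂ g A) (i j : Fin 2) : A i j ∈ K := by
  have hq : ∀ q : ℚ, (q : ℂ) ∈ K := fun q => K.algebraMap_mem q
  have e₁ := hg ![1, 0]
  have e₂ := hg ![0, 1]
  fin_cases i <;> fin_cases j
  · have := congrFun e₁ (Sum.inl 0)
    rw [ratAct_apply] at this
    simp [tangentVec, Matrix.mulVec, dotProduct] at this
    simpa [← this] using K.add_mem (hq _) (K.mul_mem (hq _) h₁)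
  · have := congrFun e₂ (Sum.inl 0)
    rw [ratAct_apply] at this
    simp [tangentVec, Matrix.mulVec, dotProduct] at this
    simpa [← this] using K.add_mem (hq _) (K.mul_mem (hq _) h₂)
  · have := congrFun e₁ (Sum.inr 0)
    rw [ratAct_apply] at this
    simp [tangentVec, Matrix.mulVec, dotProduct] at this
    simpa [← this] using K.add_mem (hq _) (K.mul_mem (hq _) h₁)
  · have := congrFun e₂ (Sum.inr 0)
    rw [ratAct_apply] at this
    simp [tangentVec, Matrix.mulVec, dotProduct] at this
    simpa [← this] using K.add_mem (hq _) (K.mul_mem (hq _) h₂)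

end IsTangentRep

/-! ### Automorphisms of the germ -/

namespace GHol

theorem v₁_zero (X : GHol) : X.v₁ 0 = 0 := by
  have h := X.odd₁.self_of_nhds
  simp only [Prod.fst_zero, Prod.snd_zero, neg_zero] at h
  exact self_eq_neg.mp h

theorem v₂_zero (X : GHol) : X.v₂ 0 = 0 := by
  have h := X.odd₂.self_of_nhds
  simp only [Prod.fst_zero, Prod.snd_zero, neg_zero] at h
  exact self_eq_neg.mp h

/-- An automorphism of the germ preserves its tangent plane: differentiate, at `z = 0`, the defining
equations along the image of the curve `z ↦ (z w₀, v₁(z w), z w₁, v₂(z w))`. -/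
theorem ratAct_tangentVec_mem (X : GHol) {g : GL Idx ℚ} (hg : g ∈ X.aut) (w : Fin 2 → ℂ) :
    ratAct g (tangentVec X.τ₁ X.τ₂ w) (Sum.inl 1) =
        X.τ₁ * ratAct g (tangentVec X.τ₁ X.τ₂ w) (Sum.inl 0) ∧
      ratAct g (tangentVec X.τ₁ X.τ₂ w) (Sum.inr 1) =
        X.τ₂ * ratAct g (tangentVec X.τ₁ X.τ₂ w) (Sum.inr 0) := by
  set p : ℂ → ℂ × ℂ := fun z => (z * w 0, z * w 1) with hp
  set c : ℂ → Idx → ℂ := fun z =>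
    Sum.elim ![z * w 0, X.v₁ (p z)] ![z * w 1, X.v₂ (p z)] with hc
  have p0 : p 0 = 0 := by simp [hp]
  have hd : ∀ a : ℂ, HasDerivAt (fun z : ℂ => z * a) a 0 := fun a => by
    simpa using (hasDerivAt_id (0 : ℂ)).mul_const a
  have hpd : HasDerivAt p (w 0, w 1) 0 := (hd _).prodMk (hd _)
  have hcd : HasDerivAt c (tangentVec X.τ₁ X.τ₂ w) 0 := by
    rw [hasDerivAt_pi]
    have l₁ := X.linear₁
    have l₂ := X.linear₂
    rw [← p0] at l₁ l₂
    have k₁ := l₁.comp_hasDerivAt (0 : ℂ) hpd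
    have k₂ := l₂.comp_hasDerivAt (0 : ℂ) hpd
    rintro (i | i) <;> fin_cases i
    · exact hd _
    · simpa [tangentVec, hc, Function.comp_def] using k₁
    · exact hd _
    · simpa [tangentVec, hc, Function.comp_def] using k₂
  have c0 : c 0 = 0 := by
    ext i
    rcases i with i | i <;> fin_cases i <;> simp [hc, p0, X.v₁_zero, X.v₂_zero]
  have hgd : ∀ i, HasDerivAt (fun z => ratAct g (c z) i)
      (ratAct g (tangentVec X.τ₁ X.τ₂ w) i) 0 := by
    intro i
    have := fun j => (hasDerivAt_pi.mp hcd) j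
    simp only [ratAct_apply]
    exact (((this _).const_mul _).add ((this _).const_mul _)).add
      (((this _).const_mul _).add ((this _).const_mul _))
  have hmem : ∀ᶠ z in 𝓝 (0 : ℂ), ratAct g (c z) ∈ graphSet X.v₁ X.v₂ := by
    have ht : Filter.Tendsto c (𝓝 0) (𝓝 0) := by
      simpa [c0] using hcd.continuousAt.tendsto
    filter_upwards [ht.eventually hg] with z hz
    exact hz.mpr ⟨rfl, rfl⟩
  have hqd := (hgd (Sum.inl 0)).prodMk (hgd (Sum.inr 0))
  have q0 : (ratAct g (c 0) (Sum.inl 0), ratAct g (c 0) (Sum.inr 0)) = (0 : ℂ × ℂ) := by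
    simp [c0, ratAct]
  have l₁ := X.linear₁
  have l₂ := X.linear₂
  rw [← q0] at l₁ l₂
  have k₁ := l₁.comp_hasDerivAt (0 : ℂ) hqd
  have k₂ := l₂.comp_hasDerivAt (0 : ℂ) hqd
  constructor
  · have := k₁.congr_of_eventuallyEq (hmem.mono fun z hz => hz.1)
    simpa using (hgd (Sum.inl 1)).unique this
  · have := k₂.congr_of_eventuallyEq (hmem.mono fun z hz => hz.2)
    simpa using (hgd (Sum.inr 1)).unique this

theorem exists_isTangentRep (X : GHol) {g : GL Idx ℚ} (hg : g ∈ X.aut) :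
    ∃ A, IsTangentRep X.τ₁ X.τ₂ g A := by
  refine ⟨!![g (Sum.inl 0) (Sum.inl 0) + g (Sum.inl 0) (Sum.inl 1) * X.τ₁,
      g (Sum.inl 0) (Sum.inr 0) + g (Sum.inl 0) (Sum.inr 1) * X.τ₂;
      g (Sum.inr 0) (Sum.inl 0) + g (Sum.inr 0) (Sum.inl 1) * X.τ₁,
      g (Sum.inr 0) (Sum.inr 0) + g (Sum.inr 0) (Sum.inr 1) * X.τ₂], fun w => ?_⟩
  obtain ⟨h₁, h₂⟩ := X.ratAct_tangentVec_mem hg w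
  have e₁ : ∀ i, ratAct g (tangentVec X.τ₁ X.τ₂ w) i =
      (g i (Sum.inl 0) + g i (Sum.inl 1) * X.τ₁) * w 0 +
        (g i (Sum.inr 0) + g i (Sum.inr 1) * X.τ₂) * w 1 := by
    intro i
    rw [ratAct_apply]
    simp [tangentVec]
    ring
  ext i
  rcases i with i | i <;> fin_cases i
  · refine (e₁ _).trans ?_
    simp [tangentVec, Matrix.mulVec, dotProduct]
  · refine h₁.trans ?_
    rw [e₁]
    simp [tangentVec, Matrix.mulVec, dotProduct]
  · refine (e₁ _).trans ?_
    simp [tangentVec, Matrix.mulVec, dotProduct]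
  · refine h₂.trans ?_
    rw [e₁]
    simp [tangentVec, Matrix.mulVec, dotProduct]

theorem iotaGL_mem_aut (X : GHol) : iotaGL ∈ X.aut := by
  have ht : Filter.Tendsto (fun x : Idx → ℂ => (x (Sum.inl 0), x (Sum.inr 0))) (𝓝 0)
      (𝓝 (0 : ℂ × ℂ)) :=
    Continuous.tendsto' (by fun_prop) _ _ rfl
  have h : ∀ᶠ x in 𝓝 (0 : Idx → ℂ),
      ratAct iotaGL x ∈ graphSet X.v₁ X.v₂ ↔ x ∈ graphSet X.v₁ X.v₂ := by
    filter_upwards [ht.eventually X.even₁, ht.eventually X.odd₂] with x h₁ h₂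
    simp [graphSet, ratAct_apply, iotaGL, h₁, h₂]
  exact h

theorem neg_iotaGL_mem_aut (X : GHol) : -iotaGL ∈ X.aut := by
  have ht : Filter.Tendsto (fun x : Idx → ℂ => (x (Sum.inl 0), x (Sum.inr 0))) (𝓝 0)
      (𝓝 (0 : ℂ × ℂ)) :=
    Continuous.tendsto' (by fun_prop) _ _ rfl
  have h : ∀ᶠ x in 𝓝 (0 : Idx → ℂ),
      ratAct (-iotaGL) x ∈ graphSet X.v₁ X.v₂ ↔ x ∈ graphSet X.v₁ X.v₂ := by
    filter_upwards [ht.eventually X.odd₁, ht.eventually X.even₂] with x h₁ h₂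
    simp [graphSet, ratAct_apply, iotaGL, h₁, h₂]
  exact h

end GHol

/-! ### Matrices of finite order over `ℚ(√-2)` -/

theorem exists_rat_of_mem_qSqrtNegTwo {z : ℂ} (hz : z ∈ qSqrtNegTwo) :
    ∃ a b : ℚ, z = a + b * (((Real.sqrt 2 : ℝ) : ℂ) * Complex.I) := by
  have hω : (((Real.sqrt 2 : ℝ) : ℂ) * Complex.I) ^ 2 = -2 := by
    rw [mul_pow, Complex.I_sq, ← Complex.ofReal_pow, Real.sq_sqrt (by norm_num)]
    norm_num
  unfold qSqrtNegTwo at hz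
  generalize ((Real.sqrt 2 : ℝ) : ℂ) * Complex.I = ω at hz hω ⊢
  induction hz using IntermediateField.adjoin_induction with
  | mem x hx =>
    rw [Set.mem_singleton_iff] at hx
    exact ⟨0, 1, by simp [hx]⟩
  | algebraMap q => exact ⟨q, 0, by simp⟩
  | add x y _ _ hx hy =>
    obtain ⟨a, b, rfl⟩ := hx
    obtain ⟨c, d, rfl⟩ := hy
    exact ⟨a + c, b + d, by push_cast; ring⟩
  | mul x y _ _ hx hy =>
    obtain ⟨a, b, rfl⟩ := hx
    obtain ⟨c, d, rfl⟩ := hy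
    exact ⟨a * c - 2 * b * d, a * d + b * c, by push_cast; linear_combination (b * d : ℂ) * hω⟩
  | inv x _ hx =>
    obtain ⟨a, b, rfl⟩ := hx
    rcases eq_or_ne (a ^ 2 + 2 * b ^ 2) 0 with h | h
    · have ha : a = 0 := by nlinarith [sq_nonneg a, sq_nonneg b]
      have hb : b = 0 := by nlinarith [sq_nonneg a, sq_nonneg b]
      exact ⟨0, 0, by simp [ha, hb]⟩
    · refine ⟨a / (a ^ 2 + 2 * b ^ 2), -b / (a ^ 2 + 2 * b ^ 2), ?_⟩
      have h' : ((a : ℂ) ^ 2 + 2 * (b : ℂ) ^ 2) ≠ 0 := by exact_mod_cast h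
      refine inv_eq_of_mul_eq_one_right ?_
      have e : ((a : ℂ) + b * ω) * (a - b * ω) = a ^ 2 + 2 * b ^ 2 := by
        linear_combination (-(b : ℂ) ^ 2) * hω
      have e' : ((a : ℂ) + b * ω) * (a / (a ^ 2 + 2 * b ^ 2) + -b / (a ^ 2 + 2 * b ^ 2) * ω) =
          ((a + b * ω) * (a - b * ω)) / (a ^ 2 + 2 * b ^ 2) := by ring
      push_cast
      rw [e', e, div_self h']

theorem inv_eq_conj_of_pow_eq_one {z : ℂ} {n : ℕ} (hn : n ≠ 0) (hz : z ^ n = 1) :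
    z⁻¹ = starRingEnd ℂ z := by
  rw [Complex.inv_def, Complex.normSq_eq_norm_sq, Complex.norm_eq_one_of_pow_eq_one hz hn]
  simp

theorem isIntegral_add_inv_of_pow_eq_one {z : ℂ} {n : ℕ} (hn : n ≠ 0) (hz : z ^ n = 1) :
    IsIntegral ℤ (z + z⁻¹) := by
  have h : ∀ x : ℂ, x ^ n = 1 → IsIntegral ℤ x := fun x hx =>
    IsIntegral.of_pow (Nat.pos_of_ne_zero hn) (hx ▸ isIntegral_one)
  exact (h z hz).add (h _ (by rw [inv_pow, hz, inv_one]))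

theorem exists_int_of_isIntegral_ratCast {q : ℚ} (h : IsIntegral ℤ (q : ℂ)) :
    ∃ n : ℤ, q = n := by
  have h' : IsIntegral ℤ q :=
    (isIntegral_algebraMap_iff (algebraMap ℚ ℂ).injective).mp (by simpa using h)
  obtain ⟨n, hn⟩ := IsIntegrallyClosed.isIntegral_iff.mp h'
  exact ⟨n, by simpa using hn.symm⟩

/-- The only roots of unity in `ℚ(√-2)` are `±1`. -/
theorem eq_one_or_eq_neg_one_of_mem_qSqrtNegTwo {z : ℂ} (hz : z ∈ qSqrtNegTwo) {n : ℕ}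
    (hn : n ≠ 0) (h : z ^ n = 1) : z = 1 ∨ z = -1 := by
  have hconj := inv_eq_conj_of_pow_eq_one hn h
  have hint := isIntegral_add_inv_of_pow_eq_one hn h
  have hnorm := Complex.norm_eq_one_of_pow_eq_one h hn
  obtain ⟨a, b, rfl⟩ := exists_rat_of_mem_qSqrtNegTwo hz
  have hN : a ^ 2 + 2 * b ^ 2 = 1 := by
    have h1 := Complex.normSq_eq_norm_sq ((a : ℂ) + b * (((Real.sqrt 2 : ℝ) : ℂ) * Complex.I))
    rw [hnorm, Complex.normSq_apply] at h1
    simp at h1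
    have h2 : Real.sqrt 2 * Real.sqrt 2 = 2 := Real.mul_self_sqrt (by norm_num)
    have h3 : (a : ℝ) ^ 2 + 2 * (b : ℝ) ^ 2 = 1 := by
      linear_combination h1 - (b : ℝ) ^ 2 * h2
    exact_mod_cast h3
  obtain ⟨m, hm⟩ : ∃ m : ℤ, 2 * a = m := by
    refine exists_int_of_isIntegral_ratCast ?_
    convert hint using 1
    rw [hconj]
    simp
    ring
  -- `2a` is the integer `z + z⁻¹`, so `(4b)² = 8 - 2(2a)²` is a rational square and an integer.
  have hs : (4 * b) ^ 2 = ((8 - 2 * m ^ 2 : ℤ) : ℚ) := by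
    push_cast
    rw [← hm]
    linear_combination 8 * hN
  have hm2 : m ^ 2 ≤ 4 := by
    have : ((8 - 2 * m ^ 2 : ℤ) : ℚ) ≥ 0 := hs ▸ sq_nonneg _
    have : (8 - 2 * m ^ 2 : ℤ) ≥ 0 := by exact_mod_cast this
    linarith
  have hsq : IsSquare (8 - 2 * m ^ 2 : ℤ) :=
    Rat.isSquare_intCast_iff.mp ⟨4 * b, by rw [← hs]; ring⟩
  obtain ⟨c, hc⟩ := hsq
  have hc3 : c ≤ 3 := by nlinarith
  have hc4 : -3 ≤ c := by nlinarith
  have hm3 : m ≤ 2 := by nlinarith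
  have hm4 : -2 ≤ m := by nlinarith
  have hb : m = 2 ∨ m = -2 → b = 0 := by
    rintro (rfl | rfl) <;> norm_num at hs <;> exact hs
  interval_cases m
  · have h0 := hb (Or.inr rfl)
    have : a = -1 := by push_cast at hm; linarith
    right; simp [h0, this]
  · interval_cases c <;> omega
  · interval_cases c <;> omega
  · interval_cases c <;> omega
  · have h0 := hb (Or.inl rfl)
    have : a = 1 := by push_cast at hm; linarith
    left; simp [h0, this]

/-- With determinant `1` and finite order the eigenvalues are `z` and `z⁻¹ = z̄`, so the trace is a
real algebraic integer in `ℚ(√-2)`, hence a rational integer. -/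
theorem trace_eq_int_of_pow_eq_one {A : Matrix (Fin 2) (Fin 2) ℂ} {n : ℕ} (hn : n ≠ 0)
    (hA : A ^ n = 1) (hdet : A.det = 1) (htr : A.trace ∈ qSqrtNegTwo) :
    ∃ k : ℤ, A.trace = k := by
  obtain ⟨z, hz⟩ := Module.End.exists_eigenvalue (Matrix.toLin' A)
  obtain ⟨w, hw⟩ := hz.exists_hasEigenvector
  have hzn : z ^ n = 1 := by
    have h1 := hw.pow_apply n
    rw [← Matrix.toLin'_pow, hA, Matrix.toLin'_one, LinearMap.id_apply] at h1
    have h2 : (z ^ n - 1) • w = 0 := by rw [sub_smul, ← h1, one_smul, sub_self]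
    exact sub_eq_zero.mp ((smul_eq_zero.mp h2).resolve_right hw.2)
  have hz0 : z ≠ 0 := by
    rintro rfl
    simp [hn] at hzn
  have hchar : z ^ 2 - A.trace * z + 1 = 0 := by
    have h1 : A * A - A.trace • A + 1 = 0 := by
      rw [Matrix.det_fin_two] at hdet
      ext i j
      fin_cases i <;> fin_cases j <;>
        simp [Matrix.trace_fin_two, Matrix.mul_apply, Fin.sum_univ_two] <;> grind
    have h2 : A.mulVec w = z • w := hw.apply_eq_smul
    have h3 := congrArg (fun B => B.mulVec w) h1
    simp only [Matrix.add_mulVec, Matrix.sub_mulVec, ← Matrix.mulVec_mulVec, h2,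
      Matrix.mulVec_smul, Matrix.smul_mulVec, Matrix.one_mulVec, Matrix.zero_mulVec] at h3
    have h4 : (z ^ 2 - A.trace * z + 1) • w = 0 := by
      rw [← h3]
      module
    exact (smul_eq_zero.mp h4).resolve_right hw.2
  have ht : A.trace = z + z⁻¹ := by
    field_simp
    linear_combination -hchar
  have hint := isIntegral_add_inv_of_pow_eq_one hn hzn
  have him : A.trace.im = 0 := by
    rw [ht, inv_eq_conj_of_pow_eq_one hn hzn]
    simp
  rw [← ht] at hint
  obtain ⟨a, b, hab⟩ := exists_rat_of_mem_qSqrtNegTwo htr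
  have hb : b = 0 := by
    rw [hab] at him
    simpa using him
  rw [hb] at hab
  simp only [Rat.cast_zero, zero_mul, add_zero] at hab
  rw [hab] at hint
  obtain ⟨k, hk⟩ := exists_int_of_isIntegral_ratCast hint
  exact ⟨k, by rw [hab, hk]; simp⟩

/-! ### Hurwitz units -/

/-- If `A² - e A + 1 = 0` with `e = ±1` and `(ι A)⁴ = -1`, then `A` is determined up to the choice
of a square root of `-2` and conjugation by a diagonal matrix. -/
theorem entries_of_pow_four_eq_neg_one {e p q r s : ℂ} (he : e ^ 2 = 1)
    (hA : !![p, q; r, s] ^ 2 - e • !![p, q; r, s] + 1 = 0)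
    (hB : (!![1, 0; 0, -1] * !![p, q; r, s]) ^ 4 = -1) :
    p + s = e ∧ (p - s) ^ 2 = -2 ∧ 4 * (q * r) = -1 := by
  have a₁ := congrFun (congrFun hA 0) 0
  have a₂ := congrFun (congrFun hA 0) 1
  have a₃ := congrFun (congrFun hA 1) 0
  have a₄ := congrFun (congrFun hA 1) 1
  rw [show (4 : ℕ) = 2 * 2 from rfl, pow_mul] at hB
  have b₁ := congrFun (congrFun hB 0) 0
  have b₄ := congrFun (congrFun hB 1) 1
  simp [pow_two, Matrix.mul_apply, Fin.sum_univ_two] at a₁ a₂ a₃ a₄ b₁ b₄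
  have htr : p + s = e := by
    by_contra hne
    -- Otherwise `A` is lower triangular and `p` is an eigenvalue with `p⁶ = 1` and `p⁴ = -1`.
    have hq : q = 0 :=
      (mul_eq_zero.mp (show q * (p + s - e) = 0 by linear_combination a₂)).resolve_right
        (sub_ne_zero.mpr hne)
    have hp : p ^ 2 = e * p - 1 := by rw [hq] at a₁; linear_combination a₁
    rw [hq] at b₁
    have h3 : p ^ 3 = -e := by linear_combination (p + e) * hp + p * he
    have h4 : p ^ 4 = -1 := by linear_combination b₁
    have h2 : p ^ 2 = -1 := by
      linear_combination p ^ 2 * h4 - (p ^ 3 - e) * h3 - he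
    have : (1 : ℂ) = -1 := by linear_combination h4 - (p ^ 2 - 1) * h2
    norm_num at this
  have hdet : q * r = p * s - 1 := by linear_combination a₁ - p * htr
  have ht : (p - s) ^ 2 = -2 := by
    have h₁ : (p * (p - s) + 1) * ((p - s) ^ 2 + 2) = 0 := by grind
    have h₄ : (1 - s * (p - s)) * ((p - s) ^ 2 + 2) = 0 := by grind
    have : ((p - s) ^ 2 + 2) ^ 2 = 0 := by linear_combination h₁ + h₄
    linear_combination pow_eq_zero_iff (two_ne_zero) |>.mp this
  exact ⟨htr, ht, by linear_combination 4 * hdet + (p + s + e) * htr - ht + he⟩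

/-- The integral solutions of `a² + b² + c² + d² = 4` are twice the `24` Hurwitz units. -/
theorem four_squares_eq_four {a b c d : ℤ} (h : a ^ 2 + b ^ 2 + c ^ 2 + d ^ 2 = 4) :
    ∃ δ : ℤ, (δ = 1 ∨ δ = -1) ∧
      ((a = 2 * δ ∧ b = 0 ∧ c = 0 ∧ d = 0) ∨ (a = 0 ∧ b = 2 * δ ∧ c = 0 ∧ d = 0) ∨
        (a = 0 ∧ b = 0 ∧ c = 2 * δ ∧ d = 0) ∨ (a = 0 ∧ b = 0 ∧ c = 0 ∧ d = 2 * δ) ∨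
        (δ = a ∧ (δ = b ∨ b = -δ) ∧ (δ = c ∨ c = -δ) ∧ (δ = d ∨ d = -δ))) := by
  have bound : ∀ x : ℤ, x ^ 2 ≤ 4 → -2 ≤ x ∧ x ≤ 2 := fun x hx =>
    ⟨by nlinarith, by nlinarith⟩
  have key : ∀ a ∈ Finset.Icc (-2 : ℤ) 2, ∀ b ∈ Finset.Icc (-2 : ℤ) 2,
      ∀ c ∈ Finset.Icc (-2 : ℤ) 2, ∀ d ∈ Finset.Icc (-2 : ℤ) 2,
      a ^ 2 + b ^ 2 + c ^ 2 + d ^ 2 = 4 → ∃ δ ∈ ({1, -1} : Finset ℤ),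
      ((a = 2 * δ ∧ b = 0 ∧ c = 0 ∧ d = 0) ∨ (a = 0 ∧ b = 2 * δ ∧ c = 0 ∧ d = 0) ∨
        (a = 0 ∧ b = 0 ∧ c = 2 * δ ∧ d = 0) ∨ (a = 0 ∧ b = 0 ∧ c = 0 ∧ d = 2 * δ) ∨
        (δ = a ∧ (δ = b ∨ b = -δ) ∧ (δ = c ∨ c = -δ) ∧ (δ = d ∨ d = -δ))) := by
    decide +kernel
  obtain ⟨δ, hδ, H⟩ := key
    a (Finset.mem_Icc.mpr (bound a (by nlinarith [sq_nonneg b, sq_nonneg c, sq_nonneg d])))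
    b (Finset.mem_Icc.mpr (bound b (by nlinarith [sq_nonneg a, sq_nonneg c, sq_nonneg d])))
    c (Finset.mem_Icc.mpr (bound c (by nlinarith [sq_nonneg a, sq_nonneg b, sq_nonneg d])))
    d (Finset.mem_Icc.mpr (bound d (by nlinarith [sq_nonneg a, sq_nonneg b, sq_nonneg c]))) h
  exact ⟨δ, by simpa using hδ, H⟩

section Quaternion

variable {e t q r : ℂ}

/-- The first quaternion unit, the square of `octElt`. The three units `I, J, K` are meant for
`e = ±1`, `t² = -2` and `4 q r = -1`. -/
noncomputable def unitI (e t q r : ℂ) : Matrix (Fin 2) (Fin 2) ℂ :=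
  !![e * t / 2, t * q; -(t * r), -(e * t / 2)]

/-- The second quaternion unit, `(ι I)²`. -/
noncomputable def unitJ (e q r : ℂ) : Matrix (Fin 2) (Fin 2) ℂ :=
  !![0, -(2 * e * q); -(2 * e * r), 0]

/-- The third quaternion unit, `I J`. -/
noncomputable def unitK (e t q r : ℂ) : Matrix (Fin 2) (Fin 2) ℂ :=
  !![e * t / 2, -(t * q); t * r, -(e * t / 2)]

/-- The element of order `8` by which `ι M` acts on the tangent plane; `e = ±1` is the trace of `M`
and `t = ±√-2` that of `ι M`. -/
noncomputable def octElt (e t q r : ℂ) : Matrix (Fin 2) (Fin 2) ℂ :=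
  !![(e + t) / 2, q; -r, -((e - t) / 2)]

theorem octElt_sq (he : e ^ 2 = 1) (ht : t ^ 2 = -2) (hqr : 4 * (q * r) = -1) :
    octElt e t q r ^ 2 = unitI e t q r := by
  ext i j
  fin_cases i <;> fin_cases j <;>
    simp [octElt, unitI, pow_two, Matrix.mul_apply, Fin.sum_univ_two] <;> grind

theorem iota_mul_unitI_sq (he : e ^ 2 = 1) (ht : t ^ 2 = -2) (hqr : 4 * (q * r) = -1) :
    (!![1, 0; 0, -1] * unitI e t q r) ^ 2 = unitJ e q r := by
  ext i j
  fin_cases i <;> fin_cases j <;>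
    simp [unitJ, unitI, pow_two, Matrix.mul_apply, Fin.sum_univ_two] <;> grind

theorem unitI_mul_unitJ (he : e ^ 2 = 1) (hqr : 4 * (q * r) = -1) :
    unitI e t q r * unitJ e q r = unitK e t q r := by
  ext i j
  fin_cases i <;> fin_cases j <;>
    simp [unitJ, unitI, unitK, Matrix.mul_apply, Fin.sum_univ_two] <;> grind

/-- The matrices `1, I, J, K` form an orthogonal basis for the trace form. -/
theorem two_smul_eq_of_traces (he : e ^ 2 = 1) (ht : t ^ 2 = -2) (hqr : 4 * (q * r) = -1)
    (G : Matrix (Fin 2) (Fin 2) ℂ) :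
    (2 : ℂ) • G = G.trace • (1 : Matrix (Fin 2) (Fin 2) ℂ)
      - (G * unitI e t q r).trace • unitI e t q r
      - (G * unitJ e q r).trace • unitJ e q r
      - (G * unitK e t q r).trace • unitK e t q r := by
  ext i j
  fin_cases i <;> fin_cases j <;>
    simp [unitJ, unitI, unitK, Matrix.trace_fin_two, Matrix.mul_apply, Fin.sum_univ_two] <;> grind

theorem sum_sq_traces (he : e ^ 2 = 1) (ht : t ^ 2 = -2) (hqr : 4 * (q * r) = -1)
    (G : Matrix (Fin 2) (Fin 2) ℂ) :
    G.trace ^ 2 + (G * unitI e t q r).trace ^ 2 + (G * unitJ e q r).trace ^ 2 +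
      (G * unitK e t q r).trace ^ 2 = 4 * G.det := by
  simp [unitJ, unitI, unitK, Matrix.trace_fin_two, Matrix.det_fin_two, Matrix.mul_apply,
    Fin.sum_univ_two]
  grind

theorem unitJ_mul_unitI (he : e ^ 2 = 1) (hqr : 4 * (q * r) = -1) :
    unitJ e q r * unitI e t q r = -unitK e t q r := by
  ext i j
  fin_cases i <;> fin_cases j <;>
    simp [unitJ, unitI, unitK, Matrix.mul_apply, Fin.sum_univ_two] <;> grind

/-- The Hurwitz units `(±1 ± I ± J ± K) / 2`, up to sign, as words in `ι`, `J` and the element of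
order `8`. -/
theorem two_smul_words (he : e ^ 2 = 1) (ht : t ^ 2 = -2) (hqr : 4 * (q * r) = -1) :
    (2 : ℂ) • (!![1, 0; 0, -1] * octElt e t q r) =
      e • (1 + unitI e t q r - unitJ e q r + unitK e t q r) ∧
    (2 : ℂ) • (!![1, 0; 0, -1] * octElt e t q r ^ 3) =
      (-e) • (1 - unitI e t q r - unitJ e q r - unitK e t q r) ∧
    (2 : ℂ) • (!![1, 0; 0, -1] * unitJ e q r * octElt e t q r) =
      (-e) • (1 + unitI e t q r + unitJ e q r - unitK e t q r) ∧
    (2 : ℂ) • (!![1, 0; 0, -1] * unitJ e q r * octElt e t q r ^ 3) =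
      e • (1 - unitI e t q r + unitJ e q r + unitK e t q r) ∧
    (2 : ℂ) • (octElt e t q r * !![1, 0; 0, -1]) =
      e • (1 + unitI e t q r + unitJ e q r + unitK e t q r) ∧
    (2 : ℂ) • (octElt e t q r ^ 3 * !![1, 0; 0, -1]) =
      (-e) • (1 - unitI e t q r + unitJ e q r - unitK e t q r) ∧
    (2 : ℂ) • (unitJ e q r * octElt e t q r * !![1, 0; 0, -1]) =
      (-e) • (1 - unitI e t q r - unitJ e q r + unitK e t q r) ∧
    (2 : ℂ) • (unitJ e q r * octElt e t q r ^ 3 * !![1, 0; 0, -1]) =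
      e • (1 + unitI e t q r - unitJ e q r - unitK e t q r) := by
  have hN3 : octElt e t q r ^ 3 = octElt e t q r * unitI e t q r := by
    rw [pow_succ', octElt_sq he ht hqr]
  rw [hN3]
  refine ⟨?_, ?_, ?_, ?_, ?_, ?_, ?_, ?_⟩
  all_goals
    ext i j
    fin_cases i <;> fin_cases j <;>
      simp [unitI, unitJ, unitK, octElt] <;> grind

theorem eq_smul_of_two_smul_eq {V : Type*} [AddCommGroup V] [Module ℂ V] {G W R : V}
    {c k d : ℂ} (hck : c * k = d) (hG : (2 : ℂ) • G = d • R) (hW : (2 : ℂ) • W = k • R) :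
    G = c • W := by
  refine smul_right_injective _ (two_ne_zero (α := ℂ)) ?_
  simp only
  rw [hG, smul_comm, hW, smul_smul, hck]

/-- A matrix of determinant `1` whose quaternion coordinates are half-integers is a Hurwitz unit, and
each Hurwitz unit is a word of the required form. -/
theorem exists_word_of_traces (he : e = 1 ∨ e = -1) (ht : t ^ 2 = -2) (hqr : 4 * (q * r) = -1)
    {G : Matrix (Fin 2) (Fin 2) ℂ} (hdet : G.det = 1) {a b c d : ℤ} (ha : G.trace = a)
    (hb : (G * unitI e t q r).trace = b) (hc : (G * unitJ e q r).trace = c)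
    (hd : (G * unitK e t q r).trace = d) :
    ∃ ε₁ ε₂ α₁ α₂ : ℕ, ε₁ ≤ 1 ∧ ε₂ ≤ 1 ∧ α₁ ≤ 1 ∧ α₂ ≤ 3 ∧
      ∃ δ : ℂ, (δ = 1 ∨ δ = -1) ∧ G = δ • (!![1, 0; 0, -1] ^ ε₁ * unitJ e q r ^ α₁ *
        octElt e t q r ^ α₂ * !![1, 0; 0, -1] ^ ε₂) := by
  have he2 : e ^ 2 = 1 := by rcases he with rfl | rfl <;> norm_num
  have hG := two_smul_eq_of_traces he2 ht hqr G
  have hs := sum_sq_traces he2 ht hqr G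
  rw [ha, hb, hc, hd] at hG hs
  rw [hdet] at hs
  have hs' : a ^ 2 + b ^ 2 + c ^ 2 + d ^ 2 = 4 := by
    have : (a : ℂ) ^ 2 + (b : ℂ) ^ 2 + (c : ℂ) ^ 2 + (d : ℂ) ^ 2 = 4 := by rw [hs]; norm_num
    exact_mod_cast this
  have hδc : ∀ {δ : ℤ}, δ = 1 ∨ δ = -1 →
      ((δ : ℂ) = 1 ∨ (δ : ℂ) = -1) ∧ (-(δ : ℂ) = 1 ∨ -(δ : ℂ) = -1) ∧
      (e * (δ : ℂ) = 1 ∨ e * (δ : ℂ) = -1) ∧ (-(e * (δ : ℂ)) = 1 ∨ -(e * (δ : ℂ)) = -1) := by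
    rintro δ (rfl | rfl) <;> rcases he with rfl | rfl <;> norm_num
  have hN2 := octElt_sq he2 ht hqr
  have hJI := unitJ_mul_unitI (t := t) he2 hqr
  obtain ⟨w₁, w₂, w₃, w₄, w₅, w₆, w₇, w₈⟩ := two_smul_words he2 ht hqr
  obtain ⟨δ, hδ, H⟩ := four_squares_eq_four hs'
  obtain ⟨h₁, h₂, h₃, h₄⟩ := hδc hδ
  have hp : e * (δ : ℂ) * e = δ := by linear_combination (δ : ℂ) * he2
  have hm : -(e * (δ : ℂ)) * -e = δ := by linear_combination (δ : ℂ) * he2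
  rcases H with ⟨rfl, rfl, rfl, rfl⟩ | ⟨rfl, rfl, rfl, rfl⟩ | ⟨rfl, rfl, rfl, rfl⟩ |
    ⟨rfl, rfl, rfl, rfl⟩ | ⟨rfl, rfl | rfl, rfl | rfl, rfl | rfl⟩ <;> push_cast at hG
  · refine ⟨0, 0, 0, 0, by simp, by simp, by simp, by simp, δ, h₁, ?_⟩
    simp only [pow_zero, mul_one]
    exact smul_right_injective _ (two_ne_zero (α := ℂ)) (hG.trans (by module))
  · refine ⟨0, 0, 0, 2, by simp, by simp, by simp, by simp, -δ, h₂, ?_⟩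
    simp only [pow_zero, one_mul, mul_one, hN2]
    exact smul_right_injective _ (two_ne_zero (α := ℂ)) (hG.trans (by module))
  · refine ⟨0, 0, 1, 0, by simp, by simp, by simp, by simp, -δ, h₂, ?_⟩
    simp only [pow_zero, pow_one, one_mul, mul_one]
    exact smul_right_injective _ (two_ne_zero (α := ℂ)) (hG.trans (by module))
  · refine ⟨0, 0, 1, 2, by simp, by simp, by simp, by simp, δ, h₁, ?_⟩
    simp only [pow_zero, pow_one, one_mul, mul_one, hN2, hJI]
    exact smul_right_injective _ (two_ne_zero (α := ℂ)) (hG.trans (by module))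
  · refine ⟨1, 0, 0, 3, by simp, by simp, by simp, by simp, -(e * δ), h₄, ?_⟩
    simp only [pow_zero, pow_one, mul_one]
    exact eq_smul_of_two_smul_eq hm (hG.trans (by module)) w₂
  · refine ⟨0, 1, 1, 1, by simp, by simp, by simp, by simp, -(e * δ), h₄, ?_⟩
    simp only [pow_zero, pow_one, one_mul]
    exact eq_smul_of_two_smul_eq hm (hG.trans (by module)) w₇
  · refine ⟨0, 1, 0, 3, by simp, by simp, by simp, by simp, -(e * δ), h₄, ?_⟩
    simp only [pow_zero, pow_one, one_mul, mul_one]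
    exact eq_smul_of_two_smul_eq hm (hG.trans (by module)) w₆
  · refine ⟨1, 0, 1, 3, by simp, by simp, by simp, by simp, e * δ, h₃, ?_⟩
    simp only [pow_zero, pow_one, mul_one]
    exact eq_smul_of_two_smul_eq hp (hG.trans (by module)) w₄
  · refine ⟨0, 1, 1, 3, by simp, by simp, by simp, by simp, e * δ, h₃, ?_⟩
    simp only [pow_zero, pow_one, one_mul]
    exact eq_smul_of_two_smul_eq hp (hG.trans (by module)) w₈
  · refine ⟨1, 0, 0, 1, by simp, by simp, by simp, by simp, e * δ, h₃, ?_⟩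
    simp only [pow_zero, pow_one, mul_one]
    exact eq_smul_of_two_smul_eq hp (hG.trans (by module)) w₁
  · refine ⟨1, 0, 1, 1, by simp, by simp, by simp, by simp, -(e * δ), h₄, ?_⟩
    simp only [pow_zero, pow_one, mul_one]
    exact eq_smul_of_two_smul_eq hm (hG.trans (by module)) w₃
  · refine ⟨0, 1, 0, 1, by simp, by simp, by simp, by simp, e * δ, h₃, ?_⟩
    simp only [pow_zero, pow_one, one_mul, mul_one]
    exact eq_smul_of_two_smul_eq hp (hG.trans (by module)) w₅

end Quaternion

/-! ### The automorphism group -/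

namespace GHol

theorem exists_pow_eq_one (X : GHol) {g : GL Idx ℚ} (hg : g ∈ X.aut) :
    ∃ n : ℕ, n ≠ 0 ∧ g ^ n = 1 := by
  have : Finite X.aut := (X.finite X.aut le_rfl).to_subtype
  obtain ⟨n, hn, h⟩ := (isOfFinOrder_of_finite (⟨g, hg⟩ : X.aut)).exists_pow_eq_one
  exact ⟨n, hn.ne', by simpa using congrArg Subtype.val h⟩

theorem det_tangentRep (X : GHol) (hτ₁ : X.τ₁ ∈ qSqrtNegTwo) (hτ₂ : X.τ₂ ∈ qSqrtNegTwo)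
    {g : GL Idx ℚ} (hg : g ∈ X.aut) {A : Matrix (Fin 2) (Fin 2) ℂ}
    (hA : IsTangentRep X.τ₁ X.τ₂ g A) : A.det = 1 ∨ A.det = -1 := by
  obtain ⟨n, hn, hgn⟩ := X.exists_pow_eq_one hg
  have hAn : A ^ n = 1 := (hA.pow n).unique (hgn ▸ IsTangentRep.one)
  have hK := hA.entry_mem hτ₁ hτ₂
  refine eq_one_or_eq_neg_one_of_mem_qSqrtNegTwo ?_ hn
    (by rw [← Matrix.det_pow, hAn, Matrix.det_one])
  rw [Matrix.det_fin_two]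
  exact sub_mem (mul_mem (hK _ _) (hK _ _)) (mul_mem (hK _ _) (hK _ _))

theorem trace_tangentRep (X : GHol) (hτ₁ : X.τ₁ ∈ qSqrtNegTwo) (hτ₂ : X.τ₂ ∈ qSqrtNegTwo)
    {g : GL Idx ℚ} (hg : g ∈ X.aut) {A : Matrix (Fin 2) (Fin 2) ℂ}
    (hA : IsTangentRep X.τ₁ X.τ₂ g A) (hdet : A.det = 1) : ∃ k : ℤ, A.trace = k := by
  obtain ⟨n, hn, hgn⟩ := X.exists_pow_eq_one hg
  have hAn : A ^ n = 1 := (hA.pow n).unique (hgn ▸ IsTangentRep.one)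
  have hK := hA.entry_mem hτ₁ hτ₂
  refine trace_eq_int_of_pow_eq_one hn hAn hdet ?_
  rw [Matrix.trace_fin_two]
  exact add_mem (hK _ _) (hK _ _)

/-- The hypotheses on the minimal polynomials of `M` and `ι M` pin down the action of `ι M`. -/
theorem iota_tangentRep_eq_octElt (X : GHol) {M : GL Idx ℚ} (hM : M ∈ X.aut)
    (hmin : minpoly ℚ (M : Matrix Idx Idx ℚ) = Polynomial.X ^ 2 + Polynomial.X + 1 ∨
      minpoly ℚ (M : Matrix Idx Idx ℚ) = Polynomial.X ^ 2 - Polynomial.X + 1)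
    (hminι : minpoly ℚ ((iotaGL * M : GL Idx ℚ) : Matrix Idx Idx ℚ) = Polynomial.X ^ 4 + 1) :
    ∃ e t q r : ℂ, (e = 1 ∨ e = -1) ∧ t ^ 2 = -2 ∧ 4 * (q * r) = -1 ∧
      IsTangentRep X.τ₁ X.τ₂ (iotaGL * M) (octElt e t q r) := by
  obtain ⟨A, hA⟩ := X.exists_isTangentRep hM
  have hB := IsTangentRep.iota.mul hA
  have hB4 : (!![1, 0; 0, -1] * A) ^ 4 = -1 := by
    refine (hB.pow 4).unique ?_
    have : (iotaGL * M) ^ 4 = -1 := by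
      have h := minpoly.aeval ℚ ((iotaGL * M : GL Idx ℚ) : Matrix Idx Idx ℚ)
      rw [hminι] at h
      simp only [map_add, map_pow, Polynomial.aeval_X, map_one] at h
      exact Units.ext (by simpa using eq_neg_of_add_eq_zero_left h)
    rw [this]
    exact IsTangentRep.one.neg
  obtain ⟨e, he, hAe⟩ : ∃ e : ℂ, (e = 1 ∨ e = -1) ∧ A ^ 2 - e • A + 1 = 0 := by
    have h := minpoly.aeval ℚ (M : Matrix Idx Idx ℚ)
    rcases hmin with hm | hm <;> rw [hm] at h <;>
      simp only [map_add, map_sub, map_pow, Polynomial.aeval_X, map_one] at h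
    · refine ⟨-1, Or.inr rfl, ?_⟩
      have := (hA.pow 2).add_smul_add_eq_zero hA IsTangentRep.one (e := 1) (by simpa using h)
      simpa using this
    · refine ⟨1, Or.inl rfl, ?_⟩
      have := (hA.pow 2).add_smul_add_eq_zero hA IsTangentRep.one (e := -1)
        (by simpa [sub_eq_add_neg] using h)
      simpa [sub_eq_add_neg] using this
  have he2 : e ^ 2 = 1 := by rcases he with rfl | rfl <;> norm_num
  obtain ⟨p, q, r, s, rfl⟩ : ∃ p q r s, A = !![p, q; r, s] := ⟨_, _, _, _, Matrix.eta_fin_two A⟩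
  obtain ⟨h₁, h₂, h₃⟩ := entries_of_pow_four_eq_neg_one he2 hAe hB4
  refine ⟨e, p - s, q, r, he, h₂, h₃, ?_⟩
  convert hB using 1
  ext i j
  fin_cases i <;> fin_cases j <;>
    simp [octElt, Matrix.mul_apply, Fin.sum_univ_two] <;> linear_combination -h₁ / 2

/-- Every rational automorphism of the germ is a word of the required form. Multiplying by `ι`, which
has determinant `-1` on the tangent plane, reduces to determinant `1`. -/
theorem mem_words_of_mem_aut (X : GHol) (hτ₁ : X.τ₁ ∈ qSqrtNegTwo) (hτ₂ : X.τ₂ ∈ qSqrtNegTwo)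
    {e t q r : ℂ} (he : e = 1 ∨ e = -1) (ht : t ^ 2 = -2) (hqr : 4 * (q * r) = -1)
    {N η g : GL Idx ℚ} (hN : N ∈ X.aut) (hη : η = (iotaGL * N ^ 2) ^ 2)
    (hrep : IsTangentRep X.τ₁ X.τ₂ N (octElt e t q r)) (hg : g ∈ X.aut) :
    ∃ ε₁ ε₂ α₁ α₂ : ℕ, ε₁ ≤ 1 ∧ ε₂ ≤ 1 ∧ α₁ ≤ 1 ∧ α₂ ≤ 3 ∧
      (g = iotaGL ^ ε₁ * η ^ α₁ * N ^ α₂ * iotaGL ^ ε₂ ∨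
        g = -(iotaGL ^ ε₁ * η ^ α₁ * N ^ α₂ * iotaGL ^ ε₂)) := by
  have he2 : e ^ 2 = 1 := by rcases he with rfl | rfl <;> norm_num
  have hI : IsTangentRep X.τ₁ X.τ₂ (N ^ 2) (unitI e t q r) :=
    octElt_sq he2 ht hqr ▸ hrep.pow 2
  have hJ : IsTangentRep X.τ₁ X.τ₂ η (unitJ e q r) := by
    rw [hη, ← iota_mul_unitI_sq he2 ht hqr]
    exact (IsTangentRep.iota.mul hI).pow 2
  have hK : IsTangentRep X.τ₁ X.τ₂ (N ^ 2 * η) (unitK e t q r) :=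
    unitI_mul_unitJ he2 hqr ▸ hI.mul hJ
  have hN2 : N ^ 2 ∈ X.aut := pow_mem hN 2
  have hηm : η ∈ X.aut := hη ▸ pow_mem (mul_mem X.iotaGL_mem_aut hN2) 2
  have dI : (unitI e t q r).det = 1 := by
    rw [unitI, Matrix.det_fin_two_of]; grind
  have dJ : (unitJ e q r).det = 1 := by
    rw [unitJ, Matrix.det_fin_two_of]; grind
  have dK : (unitK e t q r).det = 1 := by
    rw [unitK, Matrix.det_fin_two_of]; grind
  -- The traces of `G`, `G I`, `G J`, `G K` are integers because these four matrices all come from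
  -- automorphisms with determinant `1`.
  have main : ∀ g ∈ X.aut, ∀ G, IsTangentRep X.τ₁ X.τ₂ g G → G.det = 1 →
      ∃ ε₁ ε₂ α₁ α₂ : ℕ, ε₁ ≤ 1 ∧ ε₂ ≤ 1 ∧ α₁ ≤ 1 ∧ α₂ ≤ 3 ∧
      (g = iotaGL ^ ε₁ * η ^ α₁ * N ^ α₂ * iotaGL ^ ε₂ ∨
        g = -(iotaGL ^ ε₁ * η ^ α₁ * N ^ α₂ * iotaGL ^ ε₂)) := by
    intro g hg G hG hdet
    obtain ⟨a, ha⟩ := X.trace_tangentRep hτ₁ hτ₂ hg hG hdet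
    obtain ⟨b, hb⟩ := X.trace_tangentRep hτ₁ hτ₂ (mul_mem hg hN2) (hG.mul hI)
      (by rw [Matrix.det_mul, hdet, dI, one_mul])
    obtain ⟨c, hc⟩ := X.trace_tangentRep hτ₁ hτ₂ (mul_mem hg hηm) (hG.mul hJ)
      (by rw [Matrix.det_mul, hdet, dJ, one_mul])
    obtain ⟨d, hd⟩ := X.trace_tangentRep hτ₁ hτ₂ (mul_mem hg (mul_mem hN2 hηm)) (hG.mul hK)
      (by rw [Matrix.det_mul, hdet, dK, one_mul])
    obtain ⟨ε₁, ε₂, α₁, α₂, h₁, h₂, h₃, h₄, δ, hδ, hW⟩ :=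
      exists_word_of_traces he ht hqr hdet ha hb hc hd
    refine ⟨ε₁, ε₂, α₁, α₂, h₁, h₂, h₃, h₄, ?_⟩
    have hw := (((IsTangentRep.iota (τ₁ := X.τ₁) (τ₂ := X.τ₂)).pow ε₁).mul (hJ.pow α₁)).mul
      (hrep.pow α₂) |>.mul (IsTangentRep.iota.pow ε₂)
    rcases hδ with rfl | rfl
    · rw [one_smul] at hW
      exact Or.inl (hG.faithful X.im_pos₁ X.im_pos₂ (hW ▸ hw))
    · rw [neg_one_smul] at hW
      exact Or.inr (hG.faithful X.im_pos₁ X.im_pos₂ (hW ▸ hw.neg))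
  obtain ⟨G, hG⟩ := X.exists_isTangentRep hg
  rcases X.det_tangentRep hτ₁ hτ₂ hg hG with hdet | hdet
  · exact main g hg G hG hdet
  · obtain ⟨ε₁, ε₂, α₁, α₂, h₁, h₂, h₃, h₄, h⟩ :=
      main (iotaGL * g) (mul_mem X.iotaGL_mem_aut hg) _ (IsTangentRep.iota.mul hG)
        (by rw [Matrix.det_mul, hdet, Matrix.det_fin_two_of]; norm_num)
    have hι := iotaGL_mul_self
    have hpow : iotaGL ^ (1 - ε₁) = iotaGL * iotaGL ^ ε₁ := by
      interval_cases ε₁ <;> simp [hι]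
    refine ⟨1 - ε₁, ε₂, α₁, α₂, by omega, h₂, h₃, h₄, ?_⟩
    have hg' : g = iotaGL * (iotaGL * g) := by rw [← mul_assoc, hι, one_mul]
    rw [hg', hpow]
    rcases h with h | h <;> rw [h]
    · left; simp only [mul_assoc]
    · right; simp only [mul_assoc, mul_neg]

end GHol

theorem theorem9p6 (X : GHol) (hτ₁ : X.τ₁ ∈ qSqrtNegTwo) (hτ₂ : X.τ₂ ∈ qSqrtNegTwo)
    (M : GL Idx ℚ) (hM : M ∈ X.typeGroup) (hIII : IsTypeIII M)
    (hmin : minpoly ℚ (M : Matrix Idx Idx ℚ) = Polynomial.X ^ 2 + Polynomial.X + 1 ∨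
      minpoly ℚ (M : Matrix Idx Idx ℚ) = Polynomial.X ^ 2 - Polynomial.X + 1)
    (hminι : minpoly ℚ ((iotaGL * M : GL Idx ℚ) : Matrix Idx Idx ℚ) = Polynomial.X ^ 4 + 1) :
    X.typeGroup = Subgroup.closure {M, iotaGL, -iotaGL} ∧
    (∀ N ∈ X.aut, IsTypeIII N → N ∈ Subgroup.closure {M, iotaGL, -iotaGL}) ∧
    ∀ N η : GL Idx ℚ, N = iotaGL * M → η = (iotaGL * N ^ 2) ^ 2 →
      (X.typeGroup : Set (GL Idx ℚ)) =
        {g | ∃ ε₁ ε₂ α₁ α₂ : ℕ, ε₁ ≤ 1 ∧ ε₂ ≤ 1 ∧ α₁ ≤ 1 ∧ α₂ ≤ 3 ∧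
          (g = iotaGL ^ ε₁ * η ^ α₁ * N ^ α₂ * iotaGL ^ ε₂ ∨
            g = -(iotaGL ^ ε₁ * η ^ α₁ * N ^ α₂ * iotaGL ^ ε₂))} := by
  have hle : X.typeGroup ≤ X.aut := (Subgroup.closure_le _).mpr fun g hg => hg.1
  have hMa := hle hM
  obtain ⟨e, t, q, r, he, ht, hqr, hrep⟩ := X.iota_tangentRep_eq_octElt hMa hmin hminι
  have hwords : ∀ g ∈ X.aut, _ := fun g hg => X.mem_words_of_mem_aut hτ₁ hτ₂ he ht hqr
    (mul_mem X.iotaGL_mem_aut hMa) rfl hrep hg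
  set C := Subgroup.closure {M, iotaGL, -iotaGL} with hC
  have hMC : M ∈ C := Subgroup.subset_closure (by simp)
  have hιC : iotaGL ∈ C := Subgroup.subset_closure (by simp)
  have hnegC : ∀ g ∈ C, -g ∈ C := by
    intro g hg
    have h := mul_mem (mul_mem hιC (Subgroup.subset_closure (by simp) : -iotaGL ∈ C)) hg
    simpa [iotaGL_mul_self] using h
  have hNC : iotaGL * M ∈ C := mul_mem hιC hMC
  have hwC : ∀ ε₁ ε₂ α₁ α₂ : ℕ, iotaGL ^ ε₁ * ((iotaGL * (iotaGL * M) ^ 2) ^ 2) ^ α₁ *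
      (iotaGL * M) ^ α₂ * iotaGL ^ ε₂ ∈ C := fun ε₁ ε₂ α₁ α₂ =>
    mul_mem (mul_mem (mul_mem (pow_mem hιC _)
      (pow_mem (pow_mem (mul_mem hιC (pow_mem hNC _)) _) _)) (pow_mem hNC _)) (pow_mem hιC _)
  have hautC : X.aut ≤ C := by
    intro g hg
    obtain ⟨ε₁, ε₂, α₁, α₂, -, -, -, -, h | h⟩ := hwords g hg
    · exact h ▸ hwC _ _ _ _
    · exact h ▸ hnegC _ (hwC _ _ _ _)
  have hCle : C ≤ X.typeGroup := by
    refine (Subgroup.closure_le _).mpr ?_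
    rintro g (rfl | rfl | rfl)
    · exact hM
    · refine Subgroup.subset_closure ⟨X.iotaGL_mem_aut, Or.inl ?_⟩
      simp [IsTypeI, blk₁, blk₂, blk₃, blk₄, iotaGL, Matrix.det_neg]
    · refine Subgroup.subset_closure ⟨X.neg_iotaGL_mem_aut, Or.inl ?_⟩
      simp [IsTypeI, blk₁, blk₂, blk₃, blk₄, iotaGL, Matrix.fromBlocks_neg, Matrix.det_neg]
  refine ⟨le_antisymm (hle.trans hautC) hCle, fun N hN _ => hautC hN, ?_⟩
  rintro N η rfl rfl
  ext g
  refine ⟨fun hg => hwords g (hle hg), ?_⟩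
  rintro ⟨ε₁, ε₂, α₁, α₂, -, -, -, -, rfl | rfl⟩
  · exact hCle (hwC _ _ _ _)
  · exact hCle (hnegC _ (hwC _ _ _ _))
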